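/- Let $n\in\mathbb N$ and $\hbar>0$. Let $A,B$ be real symmetric positive definite $n\times n$ matrices and let $\psi\in L^2(\mathbb{R}^n)$, $\psi\neq 0$. Let $\widehat\psi\in L^2(\mathbb R^n)$ be its $\hbar$-Fourier transform, i.e. the unitary extension to $L^2(\mathbb R^n)$ of $$\widehat\psi(p)=(2\pi\hbar)^{-n/2}\int_{\mathbb{R}^n}e^{-\frac{i}{\hbar}p\cdot x}\psi(x)\,dx .$$ Suppose that there is a constant $C$ such that, for almost every $x$ and almost every $p$ in $\mathbb R^n$, $$|\psi(x)|\le C e^{-\frac14 x^TA^{-1}x},\qquad |\widehat\psi(p)|\le C e^{-\frac14 p^TB^{-1}p}.$$ Then all eigenvalues of $AB$ are real and at least $\hbar^2/4$, and the ellipsoids $$X=\{x\in\mathbb R^n:\tfrac12x^TA^{-1}x\le1\},\qquad P=\{p\in\mathbb R^n:\tfrac12p^TB^{-1}p\le1\}$$ form an $\hbar$-polar quantum pair: both are centrally symmetric convex bodies (compact convex sets with nonempty interior, equal to their negatives), and $X^{\hbar}\subset P$, where $X^{\hbar}=\{p\in\mathbb{R}^n: p^Tx\le\hbar\text{ for all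 }x\in X\}$. -/

import Mathlib

open MeasureTheory FourierTransform
open scoped Matrix

noncomputable section

/-- A centrally symmetric convex body in `ℝⁿ`: a compact convex set with nonempty interior
and `X = -X`. -/
structure IsSymmConvexBody {n : ℕ} (X : Set (EuclideanSpace ℝ (Fin n))) : Prop where
  convex : Convex ℝ X
  isCompact : IsCompact X
  interior_nonempty : (interior X).Nonempty
  neg_mem : ∀ x ∈ X, -x ∈ X

/-- The `ℏ`-polar set `{p | pᵀ x ≤ ℏ for all x ∈ X}`. -/
def hbarPolar {n : ℕ} (hbar : ℝ) (X : Set (EuclideanSpace ℝ (Fin n))) :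
    Set (EuclideanSpace ℝ (Fin n)) :=
  {p | ∀ x ∈ X, inner ℝ p x ≤ hbar}

/-- `(X, P)` is an `ℏ`-polar quantum pair: both sets are symmetric convex bodies and the
`ℏ`-polar set of `X` is contained in `P`. -/
structure IsHbarPolarQuantumPair {n : ℕ} (hbar : ℝ)
    (X P : Set (EuclideanSpace ℝ (Fin n))) : Prop where
  left_body : IsSymmConvexBody X
  right_body : IsSymmConvexBody P
  polar_subset : hbarPolar hbar X ⊆ P

/-- The quadratic form `xᵀ M x`. -/
def quadForm {n : ℕ} (M : Matrix (Fin n) (Fin n) ℝ) (x : EuclideanSpace ℝ (Fin n)) : ℝ :=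
  x.ofLp ⬝ᵥ (M *ᵥ x.ofLp)

/-- The ellipsoid `½ xᵀ A⁻¹ x ≤ 1`. -/
def covEllipsoid {n : ℕ} (A : Matrix (Fin n) (Fin n) ℝ) : Set (EuclideanSpace ℝ (Fin n)) :=
  {x | (1 / 2 : ℝ) * quadForm A⁻¹ x ≤ 1}

/-- The (unitary) `ℏ`-Fourier transform of `ψ ∈ L²(ℝⁿ)`, that is, the extension to `L²` of
`ψ̂(p) = (2πℏ)^{-n/2} ∫ e^{-i p·x/ℏ} ψ(x) dx`. Mathlib's Plancherel transform `𝓕` extends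
`ξ ↦ ∫ e^{-2πi ξ·x} ψ(x) dx`, so one substitutes `ξ = p / (2πℏ)`. -/
def hbarFourier {n : ℕ} (hbar : ℝ)
    (ψ : Lp ℂ 2 (volume : Measure (EuclideanSpace ℝ (Fin n)))) :
    EuclideanSpace ℝ (Fin n) → ℂ :=
  fun p => (((2 * Real.pi * hbar) ^ (-(n : ℝ) / 2) : ℝ) : ℂ) *
    (𝓕 ψ : Lp ℂ 2 (volume : Measure (EuclideanSpace ℝ (Fin n)))) ((2 * Real.pi * hbar)⁻¹ • p)

end

/-!
Both conclusions express the matrix inequality `ℏ² B⁻¹ ≤ 4 A`. It gives the inclusion of the polar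
of the first ellipsoid, which is `{p | pᵀ A p ≤ ℏ² / 2}`, and, tested on the real and imaginary
parts of `B w` for an eigenvector `w` of `A B`, the reality and the lower bound of the eigenvalues
(`quadForm_le_of_mem_hbarPolar`, `spectrum_mul_of_quadForm_inv_le`).

The matrix inequality follows from the non-critical case of Hardy's uncertainty principle on lines;
no simultaneous diagonalization is needed. Suppose it fails at a vector `v`. The Gaussian decay of
`ψ` makes it integrable, so its Plancherel transform is a Fourier integral
(`Lp_fourier_ae_eq_of_integrable`), and for each `ξ` the function `z ↦ 𝓕 ψ (ξ + z v)` extends to an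
entire function (`differentiable_fourierLine`). Completing the square bounds it by a multiple of
`exp (a y²)` with `a = 4π² vᵀ A v` (`norm_fourierLine_le`). On the real line it decays like
`exp (-b x²)` for every `b < π² ℏ² vᵀ B⁻¹ v`, and the failure of the inequality permits `a < b`.
The Phragmén–Lindelöf principle in sectors whose opening tends to `π / 2` then forces the function
to vanish on an open ray from the origin, hence at the origin
(`apply_zero_eq_zero_of_gaussian_bounds`). As `ξ` is arbitrary, `𝓕 ψ = 0`, and by Plancherel's
theorem `ψ = 0`, a contradiction (`quadForm_le_of_gaussian_bounds`).
-/

/-! ### Entire functions with Gaussian bounds -/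

/-- An entire function that is `O(exp (a y²))` on `ℂ` and `O(exp (-b x²))` on the real line is
controlled on the diagonal by the Phragmén–Lindelöf principle in the sector
`0 < arg z < arctan t`. Since the opening is less than `π / 2`, order-two growth is admissible
there.
For `a < b` the exponent in the bound tends to `-∞` as `t → ∞`. -/
theorem norm_apply_le_of_gaussian_bounds {g : ℂ → ℂ} (hg : Differentiable ℂ g) {M a b : ℝ}
    (ha : 0 ≤ a) (hb : 0 ≤ b)
    (him : ∀ z : ℂ, ‖g z‖ ≤ M * Real.exp (a * z.im ^ 2))
    (hre : ∀ x : ℝ, ‖g x‖ ≤ M * Real.exp (-b * x ^ 2)) {t : ℝ} (ht : 1 ≤ t) {r : ℝ} (hr : 0 < r) :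
    ‖g (r + r * Complex.I)‖ ≤ M * Real.exp ((b - (b - a) * t ^ 2) / t * r ^ 2) := by
  have ht0 : 0 < t := by linarith
  have hM : 0 ≤ M := by simpa using (norm_nonneg _).trans (him 0)
  -- `c` is chosen so that `exp ((b + c i) z²)` turns the bound on `g` into the constant `M` on the
  -- ray `y = t x` as well as on the positive real axis.
  set c : ℝ := (b - (b - a) * t ^ 2) / (2 * t) with hc
  set G : ℂ → ℂ := fun z => g z * Complex.exp ((b + c * Complex.I) * z ^ 2) with hG
  have hGd : Differentiable ℂ G := by
    rw [hG]; fun_prop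
  have hGn : ∀ z : ℂ, ‖G z‖ =
      ‖g z‖ * Real.exp (b * (z.re ^ 2 - z.im ^ 2) - 2 * c * (z.re * z.im)) := by
    intro z
    rw [hG, norm_mul, Complex.norm_exp]
    congr 2
    simp [pow_two]
    ring
  have hGle : ∀ z : ℂ, ‖G z‖ ≤
      M * Real.exp (a * z.im ^ 2 + (b * (z.re ^ 2 - z.im ^ 2) - 2 * c * (z.re * z.im))) := by
    intro z
    rw [hGn, Real.exp_add, ← mul_assoc M]
    exact mul_le_mul_of_nonneg_right (him z) (Real.exp_nonneg _)
  have hexp_re : ∀ w : ℂ, (Complex.exp w).re = Real.exp w.re * Real.cos w.im := Complex.exp_re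
  have hexp_im : ∀ w : ℂ, (Complex.exp w).im = Real.exp w.re * Real.sin w.im := Complex.exp_im
  have hθ : Real.arctan t < Real.pi / 2 := Real.arctan_lt_pi_div_two t
  have hθ0 : 0 < Real.arctan t := by simpa using Real.arctan_strictMono ht0
  -- The exponential maps the strip `0 < im w < arctan t` onto the sector.
  have key : ∀ w : ℂ, 0 ≤ w.im → w.im ≤ Real.arctan t → ‖G (Complex.exp w)‖ ≤ M := by
    intro w hw0 hw1
    refine PhragmenLindelof.horizontal_strip (f := fun w => G (Complex.exp w)) (a := 0)
      (b := Real.arctan t) (C := M) ?_ ?_ ?_ ?_ hw0 hw1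
    · exact (hGd.comp Complex.differentiable_exp).diffContOnCl
    · refine ⟨2, ?_, a + b + 2 * |c|, ?_⟩
      · rw [sub_zero, lt_div_iff₀ hθ0]; linarith
      · refine Asymptotics.IsBigO.of_bound M (Filter.Eventually.of_forall fun w => ?_)
        refine (hGle _).trans ?_
        rw [Real.norm_of_nonneg (Real.exp_nonneg _)]
        refine mul_le_mul_of_nonneg_left (Real.exp_le_exp.2 ?_) hM
        have e2 : Real.exp w.re ^ 2 ≤ Real.exp (2 * |w.re|) := by
          rw [← Real.exp_nat_mul]
          exact Real.exp_le_exp.2 (by push_cast; linarith [le_abs_self w.re])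
        have hp : (Complex.exp w).re ^ 2 + (Complex.exp w).im ^ 2 = Real.exp w.re ^ 2 := by
          rw [hexp_re, hexp_im]
          linear_combination Real.exp w.re ^ 2 * Real.sin_sq_add_cos_sq w.im
        set x := (Complex.exp w).re
        set y := (Complex.exp w).im
        have h3 : -2 * c * (x * y) ≤ 2 * |c| * (x ^ 2 + y ^ 2) := by
          calc -2 * c * (x * y) ≤ |(-2 * c) * (x * y)| := le_abs_self _
            _ = 2 * |c| * (|x| * |y|) := by simp [abs_mul]
            _ ≤ _ := by
              refine mul_le_mul_of_nonneg_left ?_ (by positivity)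
              nlinarith [sq_abs x, sq_abs y, sq_nonneg (|x| - |y|), sq_nonneg (|x|),
                sq_nonneg (|y|)]
        calc _ ≤ (a + b + 2 * |c|) * (x ^ 2 + y ^ 2) := by
              nlinarith [mul_nonneg ha (sq_nonneg x), mul_nonneg hb (sq_nonneg y)]
          _ ≤ _ := by rw [hp]; exact mul_le_mul_of_nonneg_left e2 (by positivity)
    · intro z hz
      have him0 : (Complex.exp z).im = 0 := by rw [hexp_im, hz]; simp
      have : Complex.exp z = ((Complex.exp z).re : ℂ) := Complex.ext (by simp) (by simp [him0])
      show ‖G _‖ ≤ M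
      rw [hGn, him0]
      have h := hre (Complex.exp z).re
      rw [← this] at h
      calc _ ≤ _ := mul_le_mul_of_nonneg_right h (Real.exp_nonneg _)
        _ = M := by rw [mul_assoc, ← Real.exp_add]; ring_nf; simp
    · intro z hz
      have hy : (Complex.exp z).im = t * (Complex.exp z).re := by
        rw [hexp_im, hexp_re, hz]
        have := Real.tan_mul_cos (Real.cos_arctan_pos t).ne'
        rw [Real.tan_arctan] at this
        rw [← this]; ring
      refine (hGle _).trans ?_
      rw [hy]
      refine (mul_le_mul_of_nonneg_left (Real.exp_le_one_iff.2 (le_of_eq ?_)) hM).trans_eq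
        (mul_one M)
      rw [hc]; field_simp; ring
  have h4 : Real.pi / 4 ≤ Real.arctan t := by
    rw [← Real.arctan_one]; exact Real.arctan_strictMono.monotone ht
  obtain ⟨w, hw, hw0, hw1⟩ : ∃ w : ℂ, Complex.exp w = r + r * Complex.I ∧ 0 ≤ w.im ∧
      w.im ≤ Real.arctan t := by
    refine ⟨(Real.log (r * √2) : ℝ) + (Real.pi / 4 : ℝ) * Complex.I, ?_, ?_, ?_⟩
    · have hs : √2 * √2 = 2 := Real.mul_self_sqrt (by norm_num)
      have hpos : 0 < r * √2 := by positivity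
      refine Complex.ext ?_ ?_
      · rw [Complex.exp_re]; simp [Real.exp_log hpos]; linear_combination r / 2 * hs
      · rw [Complex.exp_im]; simp [Real.exp_log hpos]; linear_combination r / 2 * hs
    · simp; positivity
    · simpa using h4
  have h5 := key w hw0 hw1
  rw [hw, hGn] at h5
  simp only [Complex.add_re, Complex.ofReal_re, Complex.mul_re, Complex.I_re, Complex.add_im,
    Complex.ofReal_im, Complex.mul_im, Complex.I_im, mul_zero, mul_one,
    add_zero, zero_add, sub_self, zero_sub] at h5
  calc _ ≤ M * (Real.exp (-(2 * c * (r * r))))⁻¹ := by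
        rwa [le_mul_inv_iff₀ (Real.exp_pos _)]
    _ = _ := by
        rw [← Real.exp_neg, neg_neg, hc]
        congr 2
        field_simp

/-- Hardy's uncertainty principle for entire functions, in the non-critical case `a < b`: the value
at the origin vanishes because `g` vanishes on the open diagonal ray, which accumulates there. -/
theorem apply_zero_eq_zero_of_gaussian_bounds {g : ℂ → ℂ} (hg : Differentiable ℂ g) {M a b : ℝ}
    (ha : 0 ≤ a) (hab : a < b)
    (him : ∀ z : ℂ, ‖g z‖ ≤ M * Real.exp (a * z.im ^ 2))
    (hre : ∀ x : ℝ, ‖g x‖ ≤ M * Real.exp (-b * x ^ 2)) : g 0 = 0 := by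
  have hdiag : ∀ r : ℝ, 0 < r → g (r + r * Complex.I) = 0 := by
    intro r hr
    have hr2 : 0 < r ^ 2 := by positivity
    have hlim : Filter.Tendsto (fun t : ℝ => M * Real.exp ((b - (b - a) * t ^ 2) / t * r ^ 2))
        Filter.atTop (nhds 0) := by
      rw [← mul_zero M]
      refine (Real.tendsto_exp_atBot.comp ?_).const_mul M
      refine Filter.Tendsto.atBot_mul_const hr2 ?_
      have h1 : Filter.Tendsto (fun t : ℝ => b * t⁻¹ + -(b - a) * t) Filter.atTop Filter.atBot :=
        (tendsto_inv_atTop_zero.const_mul b).add_atBot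
          (Filter.tendsto_id.const_mul_atTop_of_neg (by linarith))
      refine h1.congr' ?_
      filter_upwards [Filter.eventually_gt_atTop 0] with t ht
      field_simp
      ring
    have := ge_of_tendsto hlim ((Filter.eventually_ge_atTop 1).mono fun t ht =>
      norm_apply_le_of_gaussian_bounds hg ha (ha.trans hab.le) him hre ht hr)
    simpa using this
  have hcont : Continuous fun r : ℝ => g (r + r * Complex.I) := by
    have := hg.continuous
    fun_prop
  have h1 : Filter.Tendsto (fun r : ℝ => g (r + r * Complex.I)) (nhdsWithin 0 (Set.Ioi 0))
      (nhds (g 0)) := by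
    simpa using (hcont.tendsto 0).mono_left nhdsWithin_le_nhds
  refine tendsto_nhds_unique h1 (tendsto_const_nhds.congr' ?_)
  filter_upwards [self_mem_nhdsWithin] with r hr using (hdiag r hr).symm

/-! ### The Fourier transform of integrable square-integrable functions -/

section FourierLaplace

variable {E : Type*} [NormedAddCommGroup E] [InnerProductSpace ℝ E] [FiniteDimensional ℝ E]
  [MeasurableSpace E] [BorelSpace E]

theorem continuous_fourier_of_integrable {f : E → ℂ} (hf : Integrable f) : Continuous (𝓕 f) :=
  VectorFourier.fourierIntegral_continuous (L := innerₗ E) Real.continuous_fourierChar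
    continuous_inner hf

/-- For an integrable `L²` function the Plancherel transform agrees almost everywhere with the
Fourier integral, since both satisfy `∫ 𝓕 f • φ = ∫ f • 𝓕 φ` for every test function `φ`. -/
theorem Lp_fourier_ae_eq_of_integrable (f : Lp ℂ 2 (volume : Measure E)) (hf : Integrable f) :
    ∀ᵐ ξ, (𝓕 f : Lp ℂ 2 (volume : Measure E)) ξ = 𝓕 (f : E → ℂ) ξ := by
  refine ae_eq_of_integral_contDiff_smul_eq
    ((Lp.memLp _).locallyIntegrable (by norm_num))
    (continuous_fourier_of_integrable hf).locallyIntegrable fun g hg hgs => ?_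
  have hgs' : HasCompactSupport fun x => (g x : ℂ) :=
    hgs.comp_left (g := fun r : ℝ => (r : ℂ)) (by simp)
  have hg' : ContDiff ℝ (⊤ : ℕ∞) fun x => (g x : ℂ) := Complex.ofRealCLM.contDiff.comp hg
  set φ : SchwartzMap E ℂ := hgs'.toSchwartzMap hg' with hφ
  have h1 := congrArg (fun T => T φ) (Lp.fourier_toTemperedDistribution_eq f)
  simp only [TemperedDistribution.fourier_apply, Lp.toTemperedDistribution_apply] at h1
  have h2 := VectorFourier.integral_fourierIntegral_smul_eq_flip (L := innerₗ E)
    (μ := volume) (ν := volume) Real.continuous_fourierChar continuous_inner φ.integrable hf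
  rw [flip_innerₗ] at h2
  have h3 : ∫ ξ, (𝓕 φ) ξ • f ξ = ∫ ξ, φ ξ • 𝓕 (f : E → ℂ) ξ := h2
  rw [h3] at h1
  exact h1.symm

/-! ### The Fourier–Laplace transform along a complex line -/

/-- The Fourier–Laplace transform of `f` on the complex line `z ↦ ξ + z v`, that is,
`z ↦ ∫ exp (-2πi (x·ξ + z x·v)) f(x) dx`, in the normalization of Mathlib's `𝓕`. -/
noncomputable def fourierLine (f : E → ℂ) (ξ v : E) (z : ℂ) : ℂ :=
  ∫ x, Complex.exp (-2 * Real.pi * Complex.I * (inner ℝ x ξ + z * inner ℝ x v)) * f x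

theorem fourierLine_ofReal (f : E → ℂ) (ξ v : E) (t : ℝ) :
    fourierLine f ξ v t = 𝓕 f (ξ + t • v) := by
  rw [Real.fourier_eq', fourierLine]
  refine integral_congr_ae (Filter.Eventually.of_forall fun x => ?_)
  simp only [inner_add_right, inner_smul_right, smul_eq_mul]
  push_cast
  ring_nf

theorem norm_exp_fourierLine (s r : ℝ) (z : ℂ) :
    ‖Complex.exp (-2 * Real.pi * Complex.I * (s + z * r))‖ =
      Real.exp (2 * Real.pi * (z.im * r)) := by
  rw [Complex.norm_exp]
  congr 1
  simp

theorem integrable_exp_neg_mul_sq_norm {b : ℝ} (hb : 0 < b) :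
    Integrable fun x : E => Real.exp (-b * ‖x‖ ^ 2) := by
  have := (GaussianFourier.integrable_cexp_neg_mul_sq_norm_add (V := E) (b := b)
    (by simpa using hb) 0 0).norm
  refine this.congr (Filter.Eventually.of_forall fun x => ?_)
  simp only [Complex.norm_exp]
  congr 1
  simp [← Complex.ofReal_pow]

theorem mul_sub_mul_sq_le {d : ℝ} (hd : 0 < d) (k r : ℝ) :
    k * r - d * r ^ 2 ≤ k ^ 2 / (2 * d) - d / 2 * r ^ 2 := by
  have : k ^ 2 / (2 * d) - d / 2 * r ^ 2 - (k * r - d * r ^ 2) = (k - d * r) ^ 2 / (2 * d) := by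
    field_simp; ring
  have : 0 ≤ (k - d * r) ^ 2 / (2 * d) := by positivity
  linarith

/-- The Fourier–Laplace transform of a function with Gaussian decay is entire along every complex
line. -/
theorem differentiable_fourierLine {f : E → ℂ} (hfm : AEStronglyMeasurable f) {C d : ℝ}
    (hd : 0 < d) (hf : ∀ᵐ x, ‖f x‖ ≤ C * Real.exp (-d * ‖x‖ ^ 2)) (ξ v : E) :
    Differentiable ℂ (fourierLine f ξ v) := by
  intro z₀
  set R : ℝ := |z₀.im| + 1 with hR
  set k : ℝ := 2 * Real.pi * (R + 1) * ‖v‖ with hk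
  have hmeas : ∀ z : ℂ, AEStronglyMeasurable
      (fun x : E =>
        Complex.exp (-2 * Real.pi * Complex.I * (inner ℝ x ξ + z * inner ℝ x v)) * f x) := by
    intro z
    refine AEStronglyMeasurable.mul (Continuous.aestronglyMeasurable ?_) hfm
    fun_prop
  -- A Gaussian majorant, uniform on the strip `|im z| ≤ R`. The summands `1` and `2π |x·v|` of the
  -- first factor dominate the integrand and its derivative, respectively.
  have hbound : ∀ᵐ x : E, ∀ z : ℂ, |z.im| ≤ R →
      (1 + 2 * Real.pi * |inner ℝ x v|) *
        (Real.exp (2 * Real.pi * (z.im * inner ℝ x v)) * ‖f x‖) ≤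
      C * Real.exp (k ^ 2 / (2 * d)) * Real.exp (-(d / 2) * ‖x‖ ^ 2) := by
    filter_upwards [hf] with x hx z hz
    have hin : |inner ℝ x v| ≤ ‖x‖ * ‖v‖ := abs_real_inner_le_norm x v
    have hC : 0 ≤ C := by
      by_contra h
      have := (norm_nonneg _).trans hx
      nlinarith [Real.exp_pos (-d * ‖x‖ ^ 2)]
    have h1 : 1 + 2 * Real.pi * |inner ℝ x v| ≤ Real.exp (2 * Real.pi * (‖x‖ * ‖v‖)) := by
      have := Real.add_one_le_exp (2 * Real.pi * (‖x‖ * ‖v‖))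
      have := mul_le_mul_of_nonneg_left hin Real.two_pi_pos.le
      linarith
    have h2 : Real.exp (2 * Real.pi * (z.im * inner ℝ x v)) ≤
        Real.exp (2 * Real.pi * (R * (‖x‖ * ‖v‖))) := by
      refine Real.exp_le_exp.2 (mul_le_mul_of_nonneg_left ?_ Real.two_pi_pos.le)
      refine (le_abs_self _).trans ?_
      rw [abs_mul]
      exact mul_le_mul hz hin (abs_nonneg _) (by positivity)
    calc _ ≤ Real.exp (2 * Real.pi * (‖x‖ * ‖v‖)) *
          (Real.exp (2 * Real.pi * (R * (‖x‖ * ‖v‖))) * (C * Real.exp (-d * ‖x‖ ^ 2))) := by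
          gcongr
      _ = C * Real.exp (k * ‖x‖ - d * ‖x‖ ^ 2) := by
          have : k * ‖x‖ - d * ‖x‖ ^ 2 = 2 * Real.pi * (‖x‖ * ‖v‖) +
            (2 * Real.pi * (R * (‖x‖ * ‖v‖)) + -d * ‖x‖ ^ 2) := by rw [hk]; ring
          rw [this, Real.exp_add, Real.exp_add]; ring
      _ ≤ C * Real.exp (k ^ 2 / (2 * d) - d / 2 * ‖x‖ ^ 2) := by
          gcongr C * Real.exp ?_
          exact mul_sub_mul_sq_le hd k ‖x‖
      _ = _ := by rw [mul_assoc, ← Real.exp_add]; ring_nf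
  have hint : Integrable fun x : E =>
      C * Real.exp (k ^ 2 / (2 * d)) * Real.exp (-(d / 2) * ‖x‖ ^ 2) :=
    (integrable_exp_neg_mul_sq_norm (half_pos hd)).const_mul _
  have hs : {z : ℂ | |z.im| < R} ∈ nhds z₀ := by
    refine (isOpen_lt (by fun_prop) continuous_const).mem_nhds ?_
    simp [hR]
  refine (hasDerivAt_integral_of_dominated_loc_of_deriv_le (𝕜 := ℂ) hs
    (Filter.Eventually.of_forall hmeas) ?_
    (F' := fun z x => (-2 * Real.pi * Complex.I * inner ℝ x v) *
      (Complex.exp (-2 * Real.pi * Complex.I * (inner ℝ x ξ + z * inner ℝ x v)) * f x))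
    ?_ ?_ hint ?_).2.differentiableAt
  · refine hint.mono' (hmeas z₀) ?_
    filter_upwards [hbound] with x hx
    refine le_trans ?_ (hx z₀ (by simp [hR]))
    rw [norm_mul, norm_exp_fourierLine]
    refine le_mul_of_one_le_left (by positivity) ?_
    have : 0 ≤ 2 * Real.pi * |inner ℝ x v| := by positivity
    linarith
  · refine AEStronglyMeasurable.mul (Continuous.aestronglyMeasurable ?_) (hmeas z₀)
    fun_prop
  · filter_upwards [hbound] with x hx z hz
    refine le_trans ?_ (hx z (le_of_lt hz))
    rw [norm_mul, norm_mul (Complex.exp _), norm_exp_fourierLine]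
    refine mul_le_mul_of_nonneg_right ?_ (by positivity)
    simp [abs_of_pos Real.pi_pos]
  · refine Filter.Eventually.of_forall fun x z _ => ?_
    have h1 : HasDerivAt (fun z : ℂ => -2 * Real.pi * Complex.I * (inner ℝ x ξ + z * inner ℝ x v))
        (-2 * Real.pi * Complex.I * inner ℝ x v) z := by
      simpa using (((hasDerivAt_id z).mul_const (inner ℝ x v : ℂ)).const_add
        (inner ℝ x ξ : ℂ)).const_mul (-2 * Real.pi * Complex.I)
    convert! (h1.cexp.mul_const (f x)) using 1
    ring
end FourierLaplace

/-! ### Quadratic forms of positive definite matrices -/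

section Ellipsoid

variable {n : ℕ}

theorem inner_eq_dotProduct (x y : EuclideanSpace ℝ (Fin n)) :
    inner ℝ x y = x.ofLp ⬝ᵥ y.ofLp := by
  rw [EuclideanSpace.inner_eq_star_dotProduct, star_trivial, dotProduct_comm]

theorem dotProduct_mulVec_comm {M : Matrix (Fin n) (Fin n) ℝ} (hM : M.IsHermitian)
    (x y : Fin n → ℝ) : x ⬝ᵥ (M *ᵥ y) = y ⬝ᵥ (M *ᵥ x) := by
  have hT : Mᵀ = M := by simpa [Matrix.IsHermitian] using hM
  rw [Matrix.dotProduct_mulVec, ← Matrix.mulVec_transpose, hT, dotProduct_comm]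

theorem quadForm_add_smul {M : Matrix (Fin n) (Fin n) ℝ} (hM : M.IsHermitian)
    (x y : EuclideanSpace ℝ (Fin n)) (t : ℝ) :
    quadForm M (x + t • y) =
      quadForm M x + 2 * t * (x.ofLp ⬝ᵥ (M *ᵥ y.ofLp)) + t ^ 2 * quadForm M y := by
  simp only [quadForm, WithLp.ofLp_add, WithLp.ofLp_smul, Matrix.mulVec_add, Matrix.mulVec_smul,
    add_dotProduct, dotProduct_add, smul_dotProduct, dotProduct_smul, smul_eq_mul,
    dotProduct_mulVec_comm hM y.ofLp x.ofLp]
  ring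

theorem quadForm_smul (M : Matrix (Fin n) (Fin n) ℝ) (t : ℝ) (x : EuclideanSpace ℝ (Fin n)) :
    quadForm M (t • x) = t ^ 2 * quadForm M x := by
  simp only [quadForm, WithLp.ofLp_smul, Matrix.mulVec_smul, smul_dotProduct, dotProduct_smul,
    smul_eq_mul]
  ring

theorem continuous_quadForm (M : Matrix (Fin n) (Fin n) ℝ) : Continuous (quadForm M) := by
  unfold quadForm
  fun_prop

theorem quadForm_pos {M : Matrix (Fin n) (Fin n) ℝ} (hM : M.PosDef)
    {x : EuclideanSpace ℝ (Fin n)} (hx : x ≠ 0) : 0 < quadForm M x := by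
  simpa [quadForm] using hM.dotProduct_mulVec_pos (x := x.ofLp) (by simpa using hx)

theorem quadForm_nonneg {M : Matrix (Fin n) (Fin n) ℝ} (hM : M.PosDef)
    (x : EuclideanSpace ℝ (Fin n)) : 0 ≤ quadForm M x := by
  simpa [quadForm] using hM.posSemidef.dotProduct_mulVec_nonneg x.ofLp

theorem exists_mul_sq_norm_le_quadForm {M : Matrix (Fin n) (Fin n) ℝ} (hM : M.PosDef) :
    ∃ d : ℝ, 0 < d ∧ ∀ x, d * ‖x‖ ^ 2 ≤ quadForm M x := by
  obtain ⟨d, hd, h⟩ := (isCompact_sphere (0 : EuclideanSpace ℝ (Fin n)) 1).exists_forall_le'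
    (continuous_quadForm M).continuousOn (a := 0)
    (fun x hx => quadForm_pos hM (by rintro rfl; simp at hx))
  refine ⟨d, hd, fun x => ?_⟩
  rcases eq_or_ne x 0 with rfl | hx
  · simpa using quadForm_nonneg hM 0
  · have hx' : 0 < ‖x‖ := norm_pos_iff.2 hx
    have := h (‖x‖⁻¹ • x) (by simp [norm_smul, hx'.ne'])
    rw [quadForm_smul, inv_pow, inv_mul_eq_div, le_div_iff₀ (by positivity)] at this
    exact this

theorem quadForm_inv_mulVec {A : Matrix (Fin n) (Fin n) ℝ} (hA : A.PosDef)
    (v : EuclideanSpace ℝ (Fin n)) :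
    quadForm A⁻¹ (WithLp.toLp 2 (A *ᵥ v.ofLp)) = quadForm A v := by
  have hu : IsUnit A.det := (Matrix.isUnit_iff_isUnit_det A).1 hA.isUnit
  simp only [quadForm, Matrix.mulVec_mulVec, Matrix.nonsing_inv_mul _ hu, Matrix.one_mulVec]
  exact dotProduct_comm _ _

/-- Completing the square: the linear term is absorbed by the translation `x ↦ x - 2 s A v`. -/
theorem inner_sub_quadForm_inv {A : Matrix (Fin n) (Fin n) ℝ} (hA : A.PosDef)
    (x v : EuclideanSpace ℝ (Fin n)) (s : ℝ) :
    s * inner ℝ x v - 1 / 4 * quadForm A⁻¹ x =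
      s ^ 2 * quadForm A v -
        1 / 4 * quadForm A⁻¹ (x + (-(2 * s)) • WithLp.toLp 2 (A *ᵥ v.ofLp)) := by
  have hu : IsUnit A.det := (Matrix.isUnit_iff_isUnit_det A).1 hA.isUnit
  rw [quadForm_add_smul hA.inv.isHermitian, quadForm_inv_mulVec hA, inner_eq_dotProduct]
  simp only [Matrix.mulVec_mulVec, Matrix.nonsing_inv_mul _ hu, Matrix.one_mulVec]
  ring

/-! ### The uncertainty inequality in a fixed direction -/

/-- The Fourier–Laplace transform of a function dominated by `exp (-xᵀ A⁻¹ x / 4)` grows at most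
like `exp (4π² (vᵀ A v) y²)` in the imaginary direction `y v`. -/
theorem norm_fourierLine_le {A : Matrix (Fin n) (Fin n) ℝ} (hA : A.PosDef)
    {f : EuclideanSpace ℝ (Fin n) → ℂ} {C : ℝ}
    (hf : ∀ᵐ x, ‖f x‖ ≤ C * Real.exp (-(1 / 4) * quadForm A⁻¹ x))
    (ξ v : EuclideanSpace ℝ (Fin n)) (z : ℂ) :
    ‖fourierLine f ξ v z‖ ≤
      (C * ∫ x, Real.exp (-(1 / 4) * quadForm A⁻¹ x)) *
        Real.exp (4 * Real.pi ^ 2 * quadForm A v * z.im ^ 2) := by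
  set w : EuclideanSpace ℝ (Fin n) :=
    (-(2 * (2 * Real.pi * z.im))) • WithLp.toLp 2 (A *ᵥ v.ofLp) with hw
  set K : ℝ := Real.exp (4 * Real.pi ^ 2 * quadForm A v * z.im ^ 2) with hK
  obtain ⟨d, hd, hdq⟩ := exists_mul_sq_norm_le_quadForm hA.inv
  have hint : Integrable fun x => Real.exp (-(1 / 4) * quadForm A⁻¹ x) := by
    refine (integrable_exp_neg_mul_sq_norm (b := d / 4) (by positivity)).mono'
      (Continuous.aestronglyMeasurable ?_) (Filter.Eventually.of_forall fun x => ?_)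
    · have := continuous_quadForm A⁻¹
      fun_prop
    · rw [Real.norm_of_nonneg (Real.exp_nonneg _)]
      exact Real.exp_le_exp.2 (by linarith [hdq x])
  have hint' : Integrable fun x => K * C * Real.exp (-(1 / 4) * quadForm A⁻¹ (x + w)) :=
    (hint.comp_add_right w).const_mul (K * C)
  have hle : ‖fourierLine f ξ v z‖ ≤ ∫ x, K * C * Real.exp (-(1 / 4) * quadForm A⁻¹ (x + w)) := by
    refine norm_integral_le_of_norm_le hint' ?_
    filter_upwards [hf] with x hx
    rw [norm_mul, norm_exp_fourierLine]
    refine (mul_le_mul_of_nonneg_left hx (Real.exp_nonneg _)).trans_eq ?_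
    rw [mul_left_comm, ← Real.exp_add, mul_comm K C, mul_assoc C K, hK, ← Real.exp_add]
    congr 2
    have := inner_sub_quadForm_inv hA x v (2 * Real.pi * z.im)
    rw [← hw] at this
    linear_combination this
  rw [integral_const_mul, integral_add_right_eq_self
    (fun x => Real.exp (-(1 / 4) * quadForm A⁻¹ x)) w] at hle
  exact hle.trans_eq (by ring)

/-- Hardy's uncertainty principle tested in the direction `v`: if the inequality fails for some `v`,
then on each line `ξ + ℝ v` the restriction of `𝓕 ψ` vanishes at the base point `ξ`, so `𝓕 ψ = 0`. -/
theorem quadForm_le_of_gaussian_bounds {A Q : Matrix (Fin n) (Fin n) ℝ} (hA : A.PosDef)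
    (hQ : Q.PosDef) {ψ : Lp ℂ 2 (volume : Measure (EuclideanSpace ℝ (Fin n)))} (hψ : ψ ≠ 0)
    {C D : ℝ} (hx : ∀ᵐ x, ‖ψ x‖ ≤ C * Real.exp (-(1 / 4) * quadForm A⁻¹ x))
    (hξ : ∀ᵐ ξ, ‖(𝓕 ψ : Lp ℂ 2 (volume : Measure (EuclideanSpace ℝ (Fin n)))) ξ‖ ≤
      D * Real.exp (-Real.pi ^ 2 * quadForm Q ξ)) (v : EuclideanSpace ℝ (Fin n)) :
    quadForm Q v ≤ 4 * quadForm A v := by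
  by_contra! hlt
  obtain ⟨d, hd, hdq⟩ := exists_mul_sq_norm_le_quadForm hA.inv
  have hC : 0 ≤ C := by
    obtain ⟨x, hx⟩ := hx.exists
    exact nonneg_of_mul_nonneg_left ((norm_nonneg _).trans hx) (Real.exp_pos _)
  have hD : 0 ≤ D := by
    obtain ⟨x, hx⟩ := hξ.exists
    exact nonneg_of_mul_nonneg_left ((norm_nonneg _).trans hx) (Real.exp_pos _)
  have hxd : ∀ᵐ x, ‖ψ x‖ ≤ C * Real.exp (-(d / 4) * ‖x‖ ^ 2) := by
    filter_upwards [hx] with x hx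
    refine hx.trans (mul_le_mul_of_nonneg_left (Real.exp_le_exp.2 ?_) hC)
    linarith [hdq x]
  have hint : Integrable ψ :=
    ((integrable_exp_neg_mul_sq_norm (b := d / 4) (by positivity)).const_mul C).mono'
      (Lp.aestronglyMeasurable ψ) hxd
  have hae := Lp_fourier_ae_eq_of_integrable ψ hint
  have hcont := continuous_fourier_of_integrable hint
  -- By continuity, the almost everywhere bound holds everywhere, in particular on lines.
  have hF : ∀ ξ, ‖𝓕 (ψ : EuclideanSpace ℝ (Fin n) → ℂ) ξ‖ ≤
      D * Real.exp (-Real.pi ^ 2 * quadForm Q ξ) := by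
    have hcl : IsClosed {ξ | ‖𝓕 (ψ : EuclideanSpace ℝ (Fin n) → ℂ) ξ‖ ≤
        D * Real.exp (-Real.pi ^ 2 * quadForm Q ξ)} := by
      have := continuous_quadForm Q
      exact isClosed_le hcont.norm (by fun_prop)
    have hdense : Dense {ξ | ‖𝓕 (ψ : EuclideanSpace ℝ (Fin n) → ℂ) ξ‖ ≤
        D * Real.exp (-Real.pi ^ 2 * quadForm Q ξ)} := by
      refine Measure.dense_of_ae ?_ (μ := volume)
      filter_upwards [hae, hξ] with ξ h1 h2
      rwa [← h1]
    intro ξ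
    have := hdense.closure_eq
    rw [hcl.closure_eq] at this
    exact this.ge (Set.mem_univ ξ)
  have hzero : ∀ ξ, 𝓕 (ψ : EuclideanSpace ℝ (Fin n) → ℂ) ξ = 0 := by
    intro ξ
    set G := C * ∫ x, Real.exp (-(1 / 4) * quadForm A⁻¹ x) with hG
    set a := 4 * Real.pi ^ 2 * quadForm A v with ha
    have hpi : 0 < Real.pi ^ 2 := by positivity
    -- `π² vᵀ Q v = a + 2 δ`: one `δ` absorbs the cross term of the quadratic form on `ξ + t v`, the
    -- other one leaves the decay rate `a + δ > a`.
    set δ := Real.pi ^ 2 * (quadForm Q v - 4 * quadForm A v) / 2 with hδ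
    have hδ0 : 0 < δ := by rw [hδ]; have := sub_pos.2 hlt; positivity
    set k := -Real.pi ^ 2 * (2 * (ξ.ofLp ⬝ᵥ (Q *ᵥ v.ofLp))) with hk
    set M := max G (D * Real.exp (k ^ 2 / (4 * δ))) with hM
    have h0 := apply_zero_eq_zero_of_gaussian_bounds (g := fourierLine ψ ξ v) (M := M) (a := a)
      (b := a + δ)
      (differentiable_fourierLine (Lp.aestronglyMeasurable ψ) (by positivity) hxd ξ v)
      (by have := quadForm_nonneg hA v; positivity) (by linarith)
      (fun z => (norm_fourierLine_le hA hx ξ v z).trans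
        (mul_le_mul_of_nonneg_right (le_max_left _ _) (Real.exp_nonneg _)))
      (fun t => ?_)
    · have h1 := fourierLine_ofReal ψ ξ v 0
      rw [Complex.ofReal_zero, h0] at h1
      simpa using h1.symm
    · rw [fourierLine_ofReal]
      refine (hF _).trans ?_
      refine le_trans ?_ (mul_le_mul_of_nonneg_right (le_max_right _ _) (Real.exp_nonneg _))
      rw [mul_assoc, ← Real.exp_add]
      refine mul_le_mul_of_nonneg_left (Real.exp_le_exp.2 ?_) hD
      rw [quadForm_add_smul hQ.isHermitian]
      have h2 := mul_sub_mul_sq_le (d := 2 * δ) (by positivity) k t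
      have h3 : k ^ 2 / (2 * (2 * δ)) = k ^ 2 / (4 * δ) := by ring_nf
      rw [h3] at h2
      have h4 := mul_nonneg hpi.le (quadForm_nonneg hQ ξ)
      have h5 : Real.pi ^ 2 * quadForm Q v = a + 2 * δ := by rw [ha, hδ]; ring
      have h6 : -Real.pi ^ 2 * (quadForm Q ξ + 2 * t * (ξ.ofLp ⬝ᵥ (Q *ᵥ v.ofLp)) +
          t ^ 2 * quadForm Q v) = -(Real.pi ^ 2 * quadForm Q ξ) + k * t - t ^ 2 * (a + 2 * δ) := by
        rw [← h5, hk]; ring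
      rw [h6]
      linarith
  apply hψ
  have hFψ : (𝓕 ψ : Lp ℂ 2 (volume : Measure (EuclideanSpace ℝ (Fin n)))) = 0 := by
    rw [Lp.eq_zero_iff_ae_eq_zero]
    filter_upwards [hae] with ξ h
    rw [h, hzero]; rfl
  rw [← norm_eq_zero, ← Lp.norm_fourier_eq, hFψ, norm_zero]

/-- The substitution `p = 2πℏ ξ` turns decay of the `ℏ`-Fourier transform into decay of `𝓕 ψ`;
it is where the factor `(2πℏ)² / 4 = π² ℏ²` comes from. -/
theorem ae_norm_fourier_le {B : Matrix (Fin n) (Fin n) ℝ} {hbar : ℝ} (hhbar : 0 < hbar)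
    {ψ : Lp ℂ 2 (volume : Measure (EuclideanSpace ℝ (Fin n)))} {C : ℝ}
    (hp : ∀ᵐ p : EuclideanSpace ℝ (Fin n),
      ‖hbarFourier hbar ψ p‖ ≤ C * Real.exp (-(1 / 4) * quadForm B⁻¹ p)) :
    ∀ᵐ ξ, ‖(𝓕 ψ : Lp ℂ 2 (volume : Measure (EuclideanSpace ℝ (Fin n)))) ξ‖ ≤
      C / (2 * Real.pi * hbar) ^ (-(n : ℝ) / 2) *
        Real.exp (-Real.pi ^ 2 * quadForm (hbar ^ 2 • B⁻¹) ξ) := by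
  have hc : 0 < 2 * Real.pi * hbar := by positivity
  have hκ : 0 < (2 * Real.pi * hbar) ^ (-(n : ℝ) / 2) := by positivity
  have := (Measure.quasiMeasurePreserving_smul
    (volume : Measure (EuclideanSpace ℝ (Fin n))) hc.ne').ae hp
  filter_upwards [this] with ξ h
  simp only [hbarFourier] at h
  rw [smul_smul, inv_mul_cancel₀ hc.ne', one_smul, norm_mul, Complex.norm_real,
    Real.norm_of_nonneg hκ.le, quadForm_smul] at h
  rw [div_mul_eq_mul_div, le_div_iff₀ hκ, mul_comm]
  refine h.trans_eq ?_
  congr 2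
  simp only [quadForm, Matrix.smul_mulVec, dotProduct_smul, smul_eq_mul]
  ring


/-! ### Ellipsoids, polarity and the spectrum of a product -/

theorem isSymmConvexBody_covEllipsoid {A : Matrix (Fin n) (Fin n) ℝ} (hA : A.PosDef) :
    IsSymmConvexBody (covEllipsoid A) := by
  have hcont := continuous_quadForm A⁻¹
  refine ⟨?_, ?_, ?_, ?_⟩
  · intro x hx y hy s t hs ht hst
    obtain rfl : s = 1 - t := by linarith
    have hxy : (1 - t) • x + t • y = x + t • (y - x) := by module
    have h1 := quadForm_add_smul hA.inv.isHermitian x (y - x) t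
    have h2 := quadForm_add_smul hA.inv.isHermitian x (y - x) 1
    rw [one_smul, add_sub_cancel] at h2
    simp only [covEllipsoid, Set.mem_ofPred_eq] at hx hy ⊢
    rw [hxy, h1]
    nlinarith [mul_nonneg (mul_nonneg hs ht) (quadForm_nonneg hA.inv (y - x))]
  · obtain ⟨d, hd, hdq⟩ := exists_mul_sq_norm_le_quadForm hA.inv
    refine (isCompact_closedBall (0 : EuclideanSpace ℝ (Fin n)) √(2 / d)).of_isClosed_subset
      (isClosed_le (by fun_prop) continuous_const) fun x hx => ?_
    rw [mem_closedBall_zero_iff]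
    refine Real.le_sqrt_of_sq_le ?_
    rw [le_div_iff₀ hd]
    have : (1 / 2 : ℝ) * quadForm A⁻¹ x ≤ 1 := hx
    linarith [hdq x]
  · refine ⟨0, mem_interior.2 ⟨{x | (1 / 2 : ℝ) * quadForm A⁻¹ x < 1}, fun x hx =>
      show (1 / 2 : ℝ) * quadForm A⁻¹ x ≤ 1 from le_of_lt hx,
      isOpen_lt (by fun_prop) continuous_const, ?_⟩⟩
    simp [quadForm]
  · intro x hx
    have := quadForm_smul A⁻¹ (-1) x
    rw [neg_one_smul] at this
    simp only [covEllipsoid, Set.mem_ofPred_eq] at hx ⊢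
    rw [this]
    linarith

/-- The polar of the ellipsoid of `A` is tested at its boundary point in the direction `A p`. -/
theorem quadForm_le_of_mem_hbarPolar {A : Matrix (Fin n) (Fin n) ℝ} (hA : A.PosDef)
    {hbar : ℝ} {p : EuclideanSpace ℝ (Fin n)}
    (hp : p ∈ hbarPolar hbar (covEllipsoid A)) : 2 * quadForm A p ≤ hbar ^ 2 := by
  rcases eq_or_ne p 0 with rfl | hp0
  · simpa [quadForm] using sq_nonneg hbar
  have hq : 0 < quadForm A p := quadForm_pos hA hp0
  set s : ℝ := √(2 / quadForm A p) with hs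
  have hs2 : s ^ 2 * quadForm A p = 2 := by
    rw [hs, Real.sq_sqrt (by positivity), div_mul_cancel₀ _ hq.ne']
  have h := hp (s • WithLp.toLp 2 (A *ᵥ p.ofLp)) (by
    show (1 / 2 : ℝ) * quadForm A⁻¹ _ ≤ 1
    rw [quadForm_smul, quadForm_inv_mulVec hA, hs2]; norm_num)
  rw [inner_smul_right, inner_eq_dotProduct] at h
  have h' : s * quadForm A p ≤ hbar := h
  have h0 : 0 ≤ s * quadForm A p := by positivity
  nlinarith [mul_self_le_mul_self h0 h']

/-- If `c B⁻¹ ≤ A` as quadratic forms, the spectrum of `A B` is real and bounded below by `c`. For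
an eigenvector `w`, pairing `A B w = μ w` with `B w` gives `u* A u = μ u* B⁻¹ u`, where `u = B w`.
The proof carries this out for the real and imaginary parts of `w`. -/
theorem spectrum_mul_of_quadForm_inv_le {A B : Matrix (Fin n) (Fin n) ℝ} (hA : A.PosDef)
    (hB : B.PosDef) {c : ℝ} (h : ∀ v, c * quadForm B⁻¹ v ≤ quadForm A v) {μ : ℂ}
    (hμ : μ ∈ spectrum ℂ ((A * B).map ((↑) : ℝ → ℂ))) : ∃ r : ℝ, μ = (r : ℂ) ∧ c ≤ r := by
  rw [spectrum.mem_iff, Matrix.isUnit_iff_isUnit_det, isUnit_iff_ne_zero, not_not,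
    ← Matrix.exists_mulVec_eq_zero_iff] at hμ
  obtain ⟨w, hw0, hw⟩ := hμ
  rw [Matrix.sub_mulVec, sub_eq_zero, Algebra.algebraMap_eq_smul_one, Matrix.smul_mulVec,
    Matrix.one_mulVec] at hw
  set a : Fin n → ℝ := fun i => (w i).re with ha
  set b : Fin n → ℝ := fun i => (w i).im with hb
  have hre : (A * B) *ᵥ a = μ.re • a - μ.im • b := by
    ext i
    have := congrArg Complex.re (congrFun hw i)
    simpa [Matrix.mulVec, dotProduct, ha, hb] using this.symm
  have him : (A * B) *ᵥ b = μ.im • a + μ.re • b := by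
    ext i
    have := congrArg Complex.im (congrFun hw i)
    simpa [Matrix.mulVec, dotProduct, ha, hb, add_comm] using this.symm
  rw [← Matrix.mulVec_mulVec] at hre him
  have hsymmA := dotProduct_mulVec_comm hA.isHermitian (B *ᵥ a) (B *ᵥ b)
  have hsymmB := dotProduct_mulVec_comm hB.isHermitian a b
  have huB : IsUnit B.det := (Matrix.isUnit_iff_isUnit_det B).1 hB.isUnit
  have hqa := h (WithLp.toLp 2 (B *ᵥ a))
  have hqb := h (WithLp.toLp 2 (B *ᵥ b))
  simp only [quadForm, Matrix.mulVec_mulVec _ B⁻¹ B, Matrix.nonsing_inv_mul _ huB,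
    Matrix.one_mulVec] at hqa hqb
  rw [hre] at hqa hsymmA
  rw [him] at hqb hsymmA
  simp only [dotProduct_comm (B *ᵥ _), add_dotProduct, sub_dotProduct, smul_dotProduct,
    smul_eq_mul] at hqa hqb hsymmA
  have hpos : 0 < a ⬝ᵥ (B *ᵥ a) + b ⬝ᵥ (B *ᵥ b) := by
    have hna : 0 ≤ a ⬝ᵥ (B *ᵥ a) := by simpa using hB.posSemidef.dotProduct_mulVec_nonneg a
    have hnb : 0 ≤ b ⬝ᵥ (B *ᵥ b) := by simpa using hB.posSemidef.dotProduct_mulVec_nonneg b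
    by_cases h0 : a = 0
    · have hb0 : b ≠ 0 := fun hb0 => hw0 (funext fun i =>
        Complex.ext (congrFun h0 i) (congrFun hb0 i))
      have : 0 < b ⬝ᵥ (B *ᵥ b) := by simpa using hB.dotProduct_mulVec_pos hb0
      linarith
    · have : 0 < a ⬝ᵥ (B *ᵥ a) := by simpa using hB.dotProduct_mulVec_pos h0
      linarith
  set S := a ⬝ᵥ (B *ᵥ a) + b ⬝ᵥ (B *ᵥ b) with hS
  have him0 : μ.im * S = 0 := by rw [hS]; linear_combination hsymmA + μ.re * hsymmB
  have him0' : μ.im = 0 := (mul_eq_zero.1 him0).resolve_right hpos.ne'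
  refine ⟨μ.re, Complex.ext rfl (by simpa using him0'), le_of_mul_le_mul_right ?_ hpos⟩
  rw [him0'] at hqa hqb
  rw [hS]
  linarith

end Ellipsoid

theorem mainTheorem3 (n : ℕ) (hbar : ℝ) (hhbar : 0 < hbar)
    (A B : Matrix (Fin n) (Fin n) ℝ) (hA : A.PosDef) (hB : B.PosDef)
    (ψ : Lp ℂ 2 (volume : Measure (EuclideanSpace ℝ (Fin n)))) (hψ : ψ ≠ 0) (C : ℝ)
    (hx : ∀ᵐ x : EuclideanSpace ℝ (Fin n),
      ‖ψ x‖ ≤ C * Real.exp (-(1 / 4) * quadForm A⁻¹ x))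
    (hp : ∀ᵐ p : EuclideanSpace ℝ (Fin n),
      ‖hbarFourier hbar ψ p‖ ≤ C * Real.exp (-(1 / 4) * quadForm B⁻¹ p)) :
    (∀ μ : ℂ, μ ∈ spectrum ℂ ((A * B).map ((↑) : ℝ → ℂ)) →
      ∃ r : ℝ, μ = (r : ℂ) ∧ hbar ^ 2 / 4 ≤ r) ∧
    IsHbarPolarQuantumPair hbar (covEllipsoid A) (covEllipsoid B) := by
  have hh2 : 0 < hbar ^ 2 := by positivity
  have key : ∀ v, hbar ^ 2 * quadForm B⁻¹ v ≤ 4 * quadForm A v := by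
    intro v
    have := quadForm_le_of_gaussian_bounds hA (hB.inv.smul hh2) hψ hx
      (ae_norm_fourier_le hhbar hp) v
    simpa only [quadForm, Matrix.smul_mulVec, dotProduct_smul, smul_eq_mul] using this
  refine ⟨fun μ hμ => spectrum_mul_of_quadForm_inv_le hA hB (fun v => by linarith [key v]) hμ,
    isSymmConvexBody_covEllipsoid hA, isSymmConvexBody_covEllipsoid hB, fun p hpol => ?_⟩
  have h1 := quadForm_le_of_mem_hbarPolar hA hpol
  show (1 / 2 : ℝ) * quadForm B⁻¹ p ≤ 1
  refine le_of_mul_le_mul_left ?_ hh2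
  linarith [key p]
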